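/- Let $n\ge 1$, $d\ge 2$, and let $p,q\ge 0$ be integers with $p+q=n$. Let $\kappa_n=\binom{n+d-1}{d-1}$, and let $\mu_H$ be the image of the Haar probability measure on $U(d)$ under $U\mapsto U|0\rangle\langle 0|U^\dagger$. Write $P_\pi$ ($\pi\in S_n$) for the operators permuting the tensor factors of $(\mathbb C^d)^{\otimes n}$, and let $\Pi_{\mathrm{sym}}=\frac1{n!}\sum_{\pi\in S_n}P_\pi$. Let $|\tau\rangle$ be a unit vector that lies in $\mathrm{span}\{P_\pi|0\rangle^{\otimes p}|1\rangle^{\otimes q}:\pi\in S_n\}$ and is a basis vector $|(\lambda,i,0)\rangle$ of a nice Schur basis for the partition $\lambda=(n)$, i.e. a unit vector in $Y_\lambda V(w)$ for a weight subspace $V(w)$ (the span of the standard basis vectors in which each symbol $j$ occurs $w_j$ times), where $Y_\lambda=\sum_{\pi\in S_n}P_\pi$ is the Young symmetrizer. Measure $|\tau\rangle$ with the row symmetric joint measurement for $\lambda=(n)$: the POVM with elements $\kappa_n\psi^{\otimes n}\,d\mu_H(\psi)$ together with the "fail" element $I-\Pi_{\mathrm{sym}}$. On outcome $\psi$ put $\Psi=(d+n)\psi$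 (the value on "fail", which has probability $0$, is irrelevant). Let $O\in\mathbb C^{d\times d}$ be Hermitian with $\operatorname{tr}(O)=0$. (1) The Born rule for this measurement is a probability distribution under which $\operatorname{tr}(O\Psi)$ is square integrable, and $$\begin{aligned}\operatorname{Var}[\operatorname{tr}(O\Psi)]=\;&\frac{n+d}{n+d+1}\Big(\operatorname{tr}(O^2)+2p\langle 0|O^2|0\rangle+2q\langle 1|O^2|1\rangle+2pq\,|\langle 0|O|1\rangle|^2-p\langle 0|O|0\rangle^2-q\langle 1|O|1\rangle^2\Big)\\&-\frac{1}{n+d+1}\Big(p^2\langle 0|O|0\rangle^2+q^2\langle 1|O|1\rangle^2+2pq\langle 0|O|0\rangle\langle 1|O|1\rangle\Big).\end{aligned}$$ (2) Suppose moreover that the upper left $2\times 2$ block of $O$ is $\begin{bmatrix}1&1\\1&-1\end{bmatrix}$ (so $\langle 0|O|1\rangle=1$; the other entries are arbitrary subject to $O$ being Hermitian and traceless) and that $p,q=\Theta(n)$. Then, for all sufficiently large $n$, $$\frac1{n^2}\operatorname{Var}[\operatorname{tr}(O\Psi)]\ \ge\ \Omega\Big(\frac{pq}{n^2}|\langle 0|O|1\rangle|^2\Big)\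 \ge\ \Omega(1).$$ Precisely: there is a universal constant $C_1>0$ such that for every $c>0$ there are $C_2>0$ and $N$, depending only on $c$, such that for all $n\ge N$, all $d\ge2$, all such $O$ and $\tau$, and all $p,q\ge cn$ with $p+q=n$, $$\frac1{n^2}\operatorname{Var}[\operatorname{tr}(O\Psi)]\ge C_1\frac{pq}{n^2}|\langle 0|O|1\rangle|^2\ge C_2.$$ (3) Consequently the $O(n^2)\|O\|_\infty^2$ term in the general upper bound $\operatorname{Var}[\operatorname{tr}(O\Psi)]\le k\operatorname{tr}(O^2)+O(n)\|O^2\|_\infty+O(n^2)\|O\|_\infty^2$ (here $k=1$; $\|\cdot\|_\infty$ is the spectral norm) cannot be removed for this measurement: for every $d\ge 2$, every $O$ as in (2), every $c>0$ and all real $A,B$ there is $N$ such that for all $n\ge N$ and all $p,q\ge cn$ with $p+q=n$ there is a state $\tau$ as above with $$\operatorname{Var}[\operatorname{tr}(O\Psi)]>A\operatorname{tr}(O^2)+B\,n\,\|O^2\|_\infty .$$ -/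

import Mathlib

open MeasureTheory ProbabilityTheory
open scoped Matrix

namespace QuditShadow

/-! ### Haar measure on the unitary group and Haar random pure states -/

/-- The product (= Borel) sigma-algebra on complex matrices. -/
noncomputable instance instMeasurableSpaceMatrix (m n : Type*) : MeasurableSpace (Matrix m n ℂ) :=
  inferInstanceAs (MeasurableSpace (m → n → ℂ))

instance instBorelSpaceMatrix (m n : Type*) [Countable m] [Countable n] :
    BorelSpace (Matrix m n ℂ) :=
  inferInstanceAs (BorelSpace (m → n → ℂ))

noncomputable instance instMeasurableSpaceUnitary (d : ℕ) : MeasurableSpace (Matrix.unitaryGroup (Fin d) ℂ) :=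
  inferInstanceAs
    (MeasurableSpace {M : Matrix (Fin d) (Fin d) ℂ // M ∈ Matrix.unitaryGroup (Fin d) ℂ})

instance instBorelSpaceUnitary (d : ℕ) : BorelSpace (Matrix.unitaryGroup (Fin d) ℂ) :=
  inferInstanceAs
    (BorelSpace {M : Matrix (Fin d) (Fin d) ℂ // M ∈ Matrix.unitaryGroup (Fin d) ℂ})

instance instCompactSpaceUnitary (d : ℕ) : CompactSpace (Matrix.unitaryGroup (Fin d) ℂ) := by
  refine isCompact_iff_compactSpace.mp ?_
  have hK : IsCompact (Set.univ.pi fun _ : Fin d => Set.univ.pi fun _ : Fin d =>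
      Metric.closedBall (0 : ℂ) 1) :=
    isCompact_univ_pi fun _ => isCompact_univ_pi fun _ => isCompact_closedBall _ _
  refine IsCompact.of_isClosed_subset (X := Fin d → Fin d → ℂ) hK ?_ ?_
  · have h : IsClosed {M : Matrix (Fin d) (Fin d) ℂ | M * star M = 1} :=
      isClosed_eq (by fun_prop) continuous_const
    have e : ((Matrix.unitaryGroup (Fin d) ℂ : Set (Matrix (Fin d) (Fin d) ℂ))) =
        {M | M * star M = 1} := Set.ext fun _ => Matrix.mem_unitaryGroup_iff
    rw [← e] at h
    exact h
  · intro M hM i _ j _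
    simpa using entry_norm_bound_of_unitary hM i j

/-- The Haar probability measure on `U(d)`: the Haar measure giving the whole (compact) group
mass one. -/
noncomputable def haarUnitary (d : ℕ) : Measure (Matrix.unitaryGroup (Fin d) ℂ) :=
  Measure.haarMeasure ⊤

/-- The pure state `U |0⟩⟨0| U†`. -/
noncomputable def rotatedState (d : ℕ) [NeZero d] (U : Matrix.unitaryGroup (Fin d) ℂ) :
    Matrix (Fin d) (Fin d) ℂ :=
  (U : Matrix (Fin d) (Fin d) ℂ) * Matrix.single 0 0 1 * (U : Matrix (Fin d) (Fin d) ℂ)ᴴ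

/-- The Haar random state measure `μ_H` on density matrices of pure states of a qudit: the image
of the Haar measure on `U(d)`. -/
noncomputable def haarState (d : ℕ) [NeZero d] : Measure (Matrix (Fin d) (Fin d) ℂ) :=
  (haarUnitary d).map (rotatedState d)

/-! ### The space `(ℂ^d)^{⊗n}`

A vector is given by its coordinates in the standard basis `|a₁, …, aₙ⟩`, and an operator by its
matrix in that basis. -/

/-- Standard basis strings, labelling the standard basis of `(ℂ^d)^{⊗n}`. -/
abbrev Str (n d : ℕ) := Fin n → Fin d

/-- The standard basis vector `|a⟩`. -/
def ket {n d : ℕ} (a : Str n d) : Str n d → ℂ := Pi.single a 1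

/-- `P_π = ∑_a |a_{π⁻¹(1)}, …, a_{π⁻¹(n)}⟩⟨a_1, …, a_n|`. -/
def permOp {n d : ℕ} (π : Equiv.Perm (Fin n)) : Matrix (Str n d) (Str n d) ℂ :=
  Matrix.of fun b a => if b = a ∘ ⇑π⁻¹ then 1 else 0

/-- The density matrix `|τ⟩⟨τ|`. -/
def pureState {n d : ℕ} (τ : Str n d → ℂ) : Matrix (Str n d) (Str n d) ℂ :=
  Matrix.vecMulVec τ (star τ)

/-- The weight vector of a string: the number of occurrences of each symbol. -/
def weight {n d : ℕ} (a : Str n d) (i : Fin d) : ℕ :=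
  (Finset.univ.filter fun s => a s = i).card

/-- The weight subspace `V(w)`. -/
def weightSpace {n d : ℕ} (w : Fin d → ℕ) : Submodule ℂ (Str n d → ℂ) :=
  Submodule.span ℂ {v | ∃ a : Str n d, weight a = w ∧ v = ket a}

/-! ### Row lengths `lam`, row and column permutations, Young symmetrizer

`lam : Composition n` is the list of the (positive) row lengths `lam_1, …, lam_k`, with
`k = lam.length`.  The boxes are numbered from left to right and then from top to bottom:
box `s` is in row `lam.index s`, at column `lam.invEmbedding s`.  A partition is the case of a
nonincreasing list; the definitions below do not need the monotonicity. -/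

/-- The row permutation group `A_lam` as a finite set of permutations. -/
def rowPerms {n : ℕ} (lam : Composition n) : Finset (Equiv.Perm (Fin n)) :=
  Finset.univ.filter fun π => ∀ s, lam.index (π s) = lam.index s

/-- The column permutation group `B_lam` as a finite set of permutations. -/
def colPerms {n : ℕ} (lam : Composition n) : Finset (Equiv.Perm (Fin n)) :=
  Finset.univ.filter fun π => ∀ s, (lam.invEmbedding (π s) : ℕ) = (lam.invEmbedding s : ℕ)

/-- The Young symmetrizer `Y_lam = ∑_{a ∈ A_lam} P_a ∑_{b ∈ B_lam} sgn(b) P_b`. -/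
def youngSymmetrizer {n : ℕ} (d : ℕ) (lam : Composition n) : Matrix (Str n d) (Str n d) ℂ :=
  (∑ a ∈ rowPerms lam, permOp a) *
    ∑ b ∈ colPerms lam, ((Equiv.Perm.sign b : ℤ) : ℂ) • permOp b

/-- `τ` can occur as a vector `|(lam, i, 0)⟩` of the nice Schur basis: these vectors form an
arbitrary orthonormal basis of `Y_lam V(w)`, for each weight `w`. So `τ` is a unit vector
in some `Y_lam V(w)`. -/
def IsSchurVector {n d : ℕ} (lam : Composition n) (τ : Str n d → ℂ) : Prop :=
  (∃ w : Fin d → ℕ, ∃ v ∈ weightSpace (n := n) w, τ = youngSymmetrizer d lam *ᵥ v) ∧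
    star τ ⬝ᵥ τ = 1

/-! ### The row symmetric joint measurement and the shadow matrix -/

/-- The dimension `κ_s` of the symmetric subspace of `(ℂ^d)^{⊗s}`. -/
def symDim (d s : ℕ) : ℕ := (s + d - 1).choose (d - 1)

/-- The projector onto the row symmetric subspace. -/
noncomputable def rowSymProj {n : ℕ} (d : ℕ) (lam : Composition n) :
    Matrix (Str n d) (Str n d) ℂ :=
  ((rowPerms lam).card : ℂ)⁻¹ • ∑ π ∈ rowPerms lam, permOp π

/-- The POVM element `F(ψ_1, …, ψ_k) = ⨂_i κ_{lam_i} ψ_i^{⊗ lam_i}`: its matrix entries are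
products of entries, the qudit in box `s` carrying the matrix `ψ_i` of its row `i`. -/
def povmElement {n d : ℕ} (lam : Composition n)
    (ψ : Fin lam.length → Matrix (Fin d) (Fin d) ℂ) : Matrix (Str n d) (Str n d) ℂ :=
  Matrix.of fun a b =>
    (∏ i, (symDim d (lam.blocksFun i) : ℂ)) * ∏ s, ψ (lam.index s) (a s) (b s)

/-- Outcomes of the measurement: a tuple `(ψ_1, …, ψ_k)` or "fail". -/
abbrev Outcome {n : ℕ} (d : ℕ) (lam : Composition n) :=
  (Fin lam.length → Matrix (Fin d) (Fin d) ℂ) ⊕ Unit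

/-- The distribution (Born rule) of the outcome of the row symmetric joint measurement on a state
with density matrix `ρ`: density `tr(F(ψ_1, …, ψ_k) ρ)` with respect to `μ_H^k` on the tuples, and
mass `tr((I - Π_sym) ρ)` on "fail". -/
noncomputable def outcomeLaw {n : ℕ} (d : ℕ) [NeZero d] (lam : Composition n)
    (ρ : Matrix (Str n d) (Str n d) ℂ) : Measure (Outcome d lam) :=
  ((Measure.pi fun _ : Fin lam.length => haarState d).withDensity
      fun ψ => ENNReal.ofReal (povmElement lam ψ * ρ).trace.re).map Sum.inl +
    ENNReal.ofReal ((1 - rowSymProj d lam) * ρ).trace.re • Measure.dirac (Sum.inr ())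

/-- The shadow matrix `Ψ = ∑_i (d + lam_i) ψ_i`. On "fail", where it is not defined, the
value is set to `0`. -/
def shadow {n d : ℕ} (lam : Composition n) : Outcome d lam → Matrix (Fin d) (Fin d) ℂ
  | Sum.inl ψ => ∑ i, ((d + lam.blocksFun i : ℕ) : ℂ) • ψ i
  | Sum.inr _ => 0

/-- The estimate `tr(O Ψ)`, which is real for Hermitian `O`, as a real random variable. -/
def estimate {n d : ℕ} (lam : Composition n) (O : Matrix (Fin d) (Fin d) ℂ)
    (x : Outcome d lam) : ℝ :=
  (O * shadow lam x).trace.re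

/-- `Var[tr(O Ψ)]`, over the outcome of the measurement on the pure state `τ`. -/
noncomputable def estimateVar {n d : ℕ} [NeZero d] (lam : Composition n) (τ : Str n d → ℂ)
    (O : Matrix (Fin d) (Fin d) ℂ) : ℝ :=
  variance (estimate lam O) (outcomeLaw d lam (pureState τ))

/-! ### The setup -/

/-- The string labelling `|0⟩^{⊗p} |1⟩^{⊗(n-p)}`. -/
def stepString (n d p : ℕ) [NeZero d] : Str n d := fun s => if (s : ℕ) < p then 0 else 1

/-- The setup with one row `lam = (n)`, `n ≥ 1`, and qudits of dimension `d ≥ 2`: natural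
numbers `p + q = n`, a vector `τ = |(lam, i, 0)⟩` in the span of all permutations of
`|0⟩^{⊗p} |1⟩^{⊗q}`, and a traceless (Hermitian) observable `O`. -/
structure Setup (n : ℕ) (hn : 0 < n) (d : ℕ) [NeZero d] (p q : ℕ) (τ : Str n d → ℂ)
    (O : Matrix (Fin d) (Fin d) ℂ) : Prop where
  two_le : 2 ≤ d
  add_eq : p + q = n
  schur : IsSchurVector (Composition.single n hn) τ
  mem_span : τ ∈ Submodule.span ℂ
    (Set.range fun π : Equiv.Perm (Fin n) => permOp π *ᵥ ket (stepString n d p))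
  hermitian : O.IsHermitian
  traceless : O.trace = 0

/-- The upper left `2 × 2` block of `O` is `[[1, 1], [1, -1]]`; the other entries are free. -/
def HasHadamardBlock {d : ℕ} [NeZero d] (O : Matrix (Fin d) (Fin d) ℂ) : Prop :=
  O 0 0 = 1 ∧ O 0 1 = 1 ∧ O 1 0 = 1 ∧ O 1 1 = -1

/-- The spectral norm of a matrix. -/
noncomputable def specNorm {d : ℕ} (M : Matrix (Fin d) (Fin d) ℂ) : ℝ :=
  ‖Matrix.toEuclideanCLM (n := Fin d) (𝕜 := ℂ) M‖

end QuditShadow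

/-!
For a partition with a single row the Young symmetrizer is the sum of all permutations, so the
span condition determines `τ` up to a phase: it is the Dicke state of weight `w = (p, q, 0, …, 0)`.
By the Born rule, the outcome is then `U |0⟩⟨0| U†` where `U` has a density with respect to the Haar
measure that is proportional to `∏ i, |v i| ^ (2 * w i)`, with `v = U |0⟩`.

All the integrals that occur are therefore mixed moments of the coordinates of `v`. Invariance of
the Haar measure under diagonal unitaries kills those with different exponents of `v` and `star v`.
The others are found by computing `∫ |⟨z, v⟩| ^ (2 * k)` in two ways: by unitary invariance it is a
multiple of `‖z‖ ^ (2 * k)`, and the expansion of `⟨z, v⟩ ^ k` gives a polynomial in the `|z i| ^ 2`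
whose coefficients are the moments. So `multinomial(α) * ∫ ∏ i, |v i| ^ (2 * α i)` depends on `∑ α`
only, and `‖v‖ = 1` yields its value `1 / symDim d (∑ α)`.

Raising `w` by one or two then gives the first two moments of the outcome, in terms of the matrix
`W = diagonal (w i + 1)`, and the variance is a combination of `tr (O W)`, `tr ((O W) ^ 2)` and
`∑ i, w i * (w i + 1) * O i i ^ 2`. For an observable with a Hadamard block the term
`2 p q |⟨0|O|1⟩| ^ 2` outweighs all the negative ones, so the variance is at least `p q`.
-/

namespace QuditShadow

section MixedMonomial

variable {ι : Type*} [Fintype ι]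

/-- The monomial in the coordinates of a vector, with exponents `α`, and in their conjugates, with
exponents `β`. -/
noncomputable def mixedMonomial (α β : ι → ℕ) (v : ι → ℂ) : ℂ :=
  ∏ i, v i ^ α i * star (v i) ^ β i

theorem mixedMonomial_add (α α' β β' : ι → ℕ) (v : ι → ℂ) :
    mixedMonomial (α + α') (β + β') v = mixedMonomial α β v * mixedMonomial α' β' v := by
  simp only [mixedMonomial, ← Finset.prod_mul_distrib, Pi.add_apply, pow_add]
  exact Finset.prod_congr rfl fun i _ => by ring

theorem mixedMonomial_mul (α β : ι → ℕ) (v w : ι → ℂ) :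
    mixedMonomial α β (v * w) = mixedMonomial α β v * mixedMonomial α β w := by
  simp only [mixedMonomial, ← Finset.prod_mul_distrib, Pi.mul_apply, star_mul', mul_pow]
  exact Finset.prod_congr rfl fun i _ => by ring

theorem mixedMonomial_single [DecidableEq ι] (i j : ι) (k l : ℕ) (v : ι → ℂ) :
    mixedMonomial (Pi.single i k) (Pi.single j l) v = v i ^ k * star (v j) ^ l := by
  rw [mixedMonomial, Finset.prod_mul_distrib]
  simp only [Pi.single_apply, pow_ite, pow_zero, Finset.prod_ite_eq', Finset.mem_univ, if_true]

theorem mixedMonomial_self (α : ι → ℕ) (v : ι → ℂ) :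
    mixedMonomial α α v = ∏ i, ((‖v i‖ ^ 2 : ℝ) : ℂ) ^ α i := by
  simp only [mixedMonomial, ← mul_pow, ← Complex.normSq_eq_norm_sq, ← Complex.mul_conj]
  rfl

theorem continuous_mixedMonomial (α β : ι → ℕ) : Continuous (mixedMonomial α β) := by
  unfold mixedMonomial
  fun_prop

theorem dotProduct_pow_mul_star_pow [DecidableEq ι] (z v : ι → ℂ) (k : ℕ) :
    (z ⬝ᵥ v) ^ k * star (z ⬝ᵥ v) ^ k =
      ∑ α ∈ Finset.piAntidiag Finset.univ k, ∑ β ∈ Finset.piAntidiag Finset.univ k,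
        (Nat.multinomial Finset.univ α * Nat.multinomial Finset.univ β *
          mixedMonomial α β z : ℂ) * mixedMonomial α β v := by
  rw [← star_pow, dotProduct, Finset.sum_pow_eq_sum_piAntidiag, star_sum, Finset.sum_mul_sum]
  refine Finset.sum_congr rfl fun α _ => Finset.sum_congr rfl fun β _ => ?_
  simp only [mixedMonomial, star_mul', star_natCast, star_prod, star_pow, mul_pow,
    Finset.prod_mul_distrib]
  ring

theorem exists_phases_mixedMonomial_eq_neg_one {α β : ι → ℕ} (h : α ≠ β) :
    ∃ u : ι → Circle, mixedMonomial α β (fun i => (u i : ℂ)) = -1 := by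
  classical
  obtain ⟨i, hi⟩ := Function.ne_iff.mp h
  have hne : (α i - β i : ℂ) ≠ 0 := sub_ne_zero.mpr (Nat.cast_injective.ne hi)
  refine ⟨Pi.mulSingle i (Circle.exp (Real.pi / (α i - β i))), ?_⟩
  rw [mixedMonomial, Finset.prod_eq_single i]
  · rw [Pi.mulSingle_eq_same, ← Complex.exp_pi_mul_I]
    simp only [Circle.coe_exp, Complex.star_def, ← Complex.exp_conj, ← Complex.exp_nat_mul,
      ← Complex.exp_add, map_mul, Complex.conj_ofReal, Complex.conj_I]
    congr 1
    push_cast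
    field_simp
    ring
  · intro j _ hj
    simp [Pi.mulSingle_eq_of_ne hj]
  · simp

theorem eq_of_sum_mul_prod_pow_eq {R : Type*} [CommRing R] [IsDomain R] {T : Set R}
    (hT : T.Infinite) {s : Finset (ι → ℕ)} {a b : (ι → ℕ) → R}
    (h : ∀ t : ι → R, (∀ i, t i ∈ T) →
      ∑ α ∈ s, a α * ∏ i, t i ^ α i = ∑ α ∈ s, b α * ∏ i, t i ^ α i) {α : ι → ℕ} (hα : α ∈ s) :
    a α = b α := by
  classical
  let poly (c : (ι → ℕ) → R) : MvPolynomial ι R :=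
    ∑ γ ∈ s, MvPolynomial.monomial (Finsupp.equivFunOnFinite.symm γ) (c γ)
  have coeff_poly (c : (ι → ℕ) → R) :
      (poly c).coeff (Finsupp.equivFunOnFinite.symm α) = c α := by
    simp [poly, MvPolynomial.coeff_sum, MvPolynomial.coeff_monomial, hα]
  have eval_poly (c : (ι → ℕ) → R) (t : ι → R) :
      (poly c).eval t = ∑ γ ∈ s, c γ * ∏ i, t i ^ γ i := by
    simp [poly, MvPolynomial.eval_monomial, Finsupp.prod_fintype]
  have hpoly : poly a = poly b := MvPolynomial.funext_set (fun _ => T) (fun _ => hT) fun t ht => by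
    rw [eval_poly, eval_poly, h t fun i => ht i (Set.mem_univ i)]
  rw [← coeff_poly a, hpoly, coeff_poly]

end MixedMonomial

section Unitary

variable {d : ℕ}

theorem diagonal_mem_unitaryGroup (u : Fin d → Circle) :
    Matrix.diagonal (fun i => (u i : ℂ)) ∈ Matrix.unitaryGroup (Fin d) ℂ := by
  rw [Matrix.mem_unitaryGroup_iff, Matrix.star_eq_conjTranspose, Matrix.diagonal_conjTranspose,
    Matrix.diagonal_mul_diagonal, ← Matrix.diagonal_one]
  congr 1
  ext i
  simp [Complex.mul_conj]

theorem exists_unitaryGroup_row_eq [NeZero d] {u : EuclideanSpace ℂ (Fin d)} (hu : ‖u‖ = 1) :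
    ∃ V : Matrix.unitaryGroup (Fin d) ℂ, (V : Matrix (Fin d) (Fin d) ℂ) 0 = u.ofLp := by
  have hu' : Orthonormal ℂ (({0} : Set (Fin d)).domRestrict fun _ => u) :=
    ⟨fun _ => hu, fun i j hij => absurd (Subsingleton.elim i j) hij⟩
  obtain ⟨b, hb⟩ := hu'.exists_orthonormalBasis_extension_of_card_eq (by simp)
  refine ⟨⟨_, Matrix.transpose_mem_unitaryGroup_iff.mpr
    ((EuclideanSpace.basisFun (Fin d) ℂ).toMatrix_orthonormalBasis_mem_unitary b)⟩, ?_⟩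
  ext j
  simp [Module.Basis.toMatrix_apply, hb 0 rfl]

theorem exists_unitaryGroup_smul_row_eq [NeZero d] (z : Fin d → ℂ) :
    ∃ V : Matrix.unitaryGroup (Fin d) ℂ,
      z = (√(∑ i, ‖z i‖ ^ 2) : ℂ) • (V : Matrix (Fin d) (Fin d) ℂ) 0 := by
  have hnorm : √(∑ i, ‖z i‖ ^ 2) = ‖WithLp.toLp 2 z‖ := (EuclideanSpace.norm_eq _).symm
  rcases eq_or_ne (WithLp.toLp 2 z) 0 with hz | hz
  · exact ⟨1, by rw [hnorm, hz, norm_zero, Complex.ofReal_zero, zero_smul]; simpa using hz⟩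
  · obtain ⟨V, hV⟩ := exists_unitaryGroup_row_eq (norm_smul_inv_norm (𝕜 := ℂ) hz)
    refine ⟨V, ?_⟩
    rw [hnorm, hV, WithLp.ofLp_smul, smul_smul]
    simp [hz]

instance instIsHaarMeasureHaarUnitary (d : ℕ) : (haarUnitary d).IsHaarMeasure :=
  inferInstanceAs (Measure.haarMeasure ⊤).IsHaarMeasure

instance instIsProbabilityMeasureHaarUnitary (d : ℕ) : IsProbabilityMeasure (haarUnitary d) :=
  ⟨Measure.haarMeasure_self⟩

theorem integrable_haarUnitary_of_continuous {E : Type*} [NormedAddCommGroup E]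
    {f : Matrix.unitaryGroup (Fin d) ℂ → E} (hf : Continuous f) : Integrable f (haarUnitary d) :=
  hf.integrable_of_hasCompactSupport (HasCompactSupport.of_compactSpace f)

variable [NeZero d]

/-- The vector `U |0⟩`. -/
def rotatedKet (U : Matrix.unitaryGroup (Fin d) ℂ) : Fin d → ℂ :=
  fun i => (U : Matrix (Fin d) (Fin d) ℂ) i 0

@[fun_prop]
theorem continuous_rotatedKet : Continuous (rotatedKet (d := d)) :=
  continuous_pi fun i => continuous_subtype_val.matrix_elem i 0

theorem sum_norm_sq_rotatedKet (U : Matrix.unitaryGroup (Fin d) ℂ) :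
    ∑ i, ‖rotatedKet U i‖ ^ 2 = 1 := by
  have h := congr_fun₂ (Matrix.UnitaryGroup.star_mul_self U) 0 0
  rw [Matrix.mul_apply, Matrix.one_apply_eq] at h
  apply Complex.ofReal_injective
  rw [Complex.ofReal_one, ← h, Complex.ofReal_sum]
  exact Finset.sum_congr rfl fun i _ => by
    rw [← Complex.normSq_eq_norm_sq, Complex.normSq_eq_conj_mul_self]; rfl

theorem rotatedState_apply (U : Matrix.unitaryGroup (Fin d) ℂ) (i j : Fin d) :
    rotatedState d U i j = rotatedKet U i * star (rotatedKet U j) := by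
  simp [rotatedState, rotatedKet, Matrix.mul_apply, Matrix.single_apply, ite_and]

theorem integral_comp_mulVec_rotatedKet {E : Type*} [NormedAddCommGroup E] [NormedSpace ℝ E]
    (V : Matrix.unitaryGroup (Fin d) ℂ) (f : (Fin d → ℂ) → E) :
    ∫ U, f ((V : Matrix (Fin d) (Fin d) ℂ) *ᵥ rotatedKet U) ∂haarUnitary d =
      ∫ U, f (rotatedKet U) ∂haarUnitary d :=
  integral_mul_left_eq_self (fun U => f (rotatedKet U)) V

end Unitary

section HaarMoment

variable {d : ℕ} [NeZero d]

/-- The mixed moments of the coordinates of the Haar random unit vector `U |0⟩`. -/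
noncomputable def haarMoment (α β : Fin d → ℕ) : ℂ :=
  ∫ U, mixedMonomial α β (rotatedKet U) ∂haarUnitary d

theorem integrable_mixedMonomial_rotatedKet (α β : Fin d → ℕ) :
    Integrable (fun U => mixedMonomial α β (rotatedKet U)) (haarUnitary d) :=
  integrable_haarUnitary_of_continuous
    ((continuous_mixedMonomial α β).comp continuous_rotatedKet)

theorem haarMoment_eq_zero_of_ne {α β : Fin d → ℕ} (h : α ≠ β) : haarMoment α β = 0 := by
  -- Multiplying by a diagonal matrix of phases leaves the law of `U |0⟩` invariant.
  obtain ⟨u, hu⟩ := exists_phases_mixedMonomial_eq_neg_one h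
  have hphase (v : Fin d → ℂ) :
      mixedMonomial α β (Matrix.diagonal (fun i => (u i : ℂ)) *ᵥ v) = -mixedMonomial α β v := by
    rw [show Matrix.diagonal (fun i => (u i : ℂ)) *ᵥ v = (fun i => (u i : ℂ)) * v from
      funext (Matrix.mulVec_diagonal _ v), mixedMonomial_mul, hu, neg_one_mul]
  have hinv := integral_comp_mulVec_rotatedKet ⟨_, diagonal_mem_unitaryGroup u⟩
    (mixedMonomial α β)
  simp only [hphase, integral_neg] at hinv
  exact self_eq_neg.mp hinv.symm

theorem integral_dotProduct_rotatedKet_pow (z : Fin d → ℂ) (k : ℕ) :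
    ∫ U, (z ⬝ᵥ rotatedKet U) ^ k * star (z ⬝ᵥ rotatedKet U) ^ k ∂haarUnitary d =
      ((∑ i, ‖z i‖ ^ 2 : ℝ) : ℂ) ^ k * haarMoment (d := d) (Pi.single 0 k) (Pi.single 0 k) := by
  obtain ⟨V, hV⟩ := exists_unitaryGroup_smul_row_eq z
  set r := √(∑ i, ‖z i‖ ^ 2)
  have hr : ((∑ i, ‖z i‖ ^ 2 : ℝ) : ℂ) = r * star (r : ℂ) := by
    rw [Complex.star_def, Complex.conj_ofReal, ← Complex.ofReal_mul,
      Real.mul_self_sqrt (Finset.sum_nonneg fun _ _ => sq_nonneg _)]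
  have hdot (v : Fin d → ℂ) : z ⬝ᵥ v = r * ((V : Matrix (Fin d) (Fin d) ℂ) *ᵥ v) 0 := by
    rw [hV, smul_dotProduct]; rfl
  calc ∫ U, (z ⬝ᵥ rotatedKet U) ^ k * star (z ⬝ᵥ rotatedKet U) ^ k ∂haarUnitary d
    _ = ∫ U, (r * star (r : ℂ)) ^ k * mixedMonomial (Pi.single 0 k) (Pi.single 0 k)
          ((V : Matrix (Fin d) (Fin d) ℂ) *ᵥ rotatedKet U) ∂haarUnitary d := by
      simp only [hdot, mixedMonomial_single, star_mul', mul_pow]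
      congr 1 with U
      ring
    _ = _ := by rw [integral_const_mul, integral_comp_mulVec_rotatedKet V (mixedMonomial _ _),
                  hr, haarMoment]

theorem integral_dotProduct_rotatedKet_pow_eq_sum (z : Fin d → ℂ) (k : ℕ) :
    ∫ U, (z ⬝ᵥ rotatedKet U) ^ k * star (z ⬝ᵥ rotatedKet U) ^ k ∂haarUnitary d =
      ∑ α ∈ Finset.piAntidiag Finset.univ k,
        (Nat.multinomial Finset.univ α ^ 2 * haarMoment α α : ℂ) *
          ∏ i, ((‖z i‖ ^ 2 : ℝ) : ℂ) ^ α i := by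
  simp only [dotProduct_pow_mul_star_pow]
  have hint (α β : Fin d → ℕ) (c : ℂ) :
      Integrable (fun U => c * mixedMonomial α β (rotatedKet U)) (haarUnitary d) :=
    (integrable_mixedMonomial_rotatedKet α β).const_mul c
  rw [integral_finsetSum _ fun α _ => integrable_finsetSum _ fun β _ => hint α β _]
  refine Finset.sum_congr rfl fun α hα => ?_
  rw [integral_finsetSum _ fun β _ => hint α β _, Finset.sum_eq_single_of_mem α hα]
  · rw [integral_const_mul, mixedMonomial_self, haarMoment]
    ring
  · intro β _ hβ
    rw [integral_const_mul, ← haarMoment, haarMoment_eq_zero_of_ne hβ.symm, mul_zero]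

theorem multinomial_mul_haarMoment (α : Fin d → ℕ) :
    Nat.multinomial Finset.univ α * haarMoment α α =
      haarMoment (d := d) (Pi.single 0 (∑ i, α i)) (Pi.single 0 (∑ i, α i)) := by
  -- Compare coefficients in the two evaluations of `∫ |z ⬝ᵥ U|0⟩| ^ (2 * k)`, both polynomials in
  -- the `‖z i‖ ^ 2`.
  set k := ∑ i, α i with hk
  set c := haarMoment (d := d) (Pi.single 0 k) (Pi.single 0 k)
  have hnonneg_infinite : (Complex.ofReal '' Set.Ici 0).Infinite :=
    (Set.Ici_infinite 0).image Complex.ofReal_injective.injOn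
  have hcoeff : (Nat.multinomial Finset.univ α ^ 2 * haarMoment α α : ℂ) =
      Nat.multinomial Finset.univ α * c := by
    refine eq_of_sum_mul_prod_pow_eq (s := Finset.piAntidiag Finset.univ k)
      (a := fun β => (Nat.multinomial Finset.univ β ^ 2 * haarMoment β β : ℂ))
      (b := fun β => Nat.multinomial Finset.univ β * c) hnonneg_infinite (fun t ht => ?_)
      (Finset.mem_piAntidiag.mpr ⟨hk.symm, fun i _ => Finset.mem_univ i⟩)
    choose s hs hst using ht
    have hnorm (i : Fin d) : ((‖(√(s i) : ℂ)‖ ^ 2 : ℝ) : ℂ) = t i := by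
      rw [Complex.norm_real, Real.norm_eq_abs, sq_abs, Real.sq_sqrt (hs i), hst]
    have h := integral_dotProduct_rotatedKet_pow_eq_sum (fun i => (√(s i) : ℂ)) k
    rw [integral_dotProduct_rotatedKet_pow, Complex.ofReal_sum] at h
    simp only [hnorm] at h
    rw [← h, Finset.sum_pow_eq_sum_piAntidiag, Finset.sum_mul]
    exact Finset.sum_congr rfl fun β _ => by ring
  have hpos : (Nat.multinomial Finset.univ α : ℂ) ≠ 0 :=
    Nat.cast_ne_zero.mpr (Nat.multinomial_pos _ _).ne'
  exact mul_left_cancel₀ hpos (by rw [← hcoeff]; ring)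

omit [NeZero d] in
theorem sum_multinomial_mul_mixedMonomial_self (k : ℕ) (v : Fin d → ℂ) :
    ∑ α ∈ Finset.piAntidiag Finset.univ k,
      Nat.multinomial Finset.univ α * mixedMonomial α α v = ((∑ i, ‖v i‖ ^ 2 : ℝ) : ℂ) ^ k := by
  rw [Complex.ofReal_sum, Finset.sum_pow_eq_sum_piAntidiag]
  simp only [mixedMonomial_self]

theorem card_piAntidiag_univ (k : ℕ) :
    (Finset.piAntidiag (Finset.univ : Finset (Fin d)) k).card = symDim d k := by
  rw [← Finset.map_sym_eq_piAntidiag, Finset.card_map, Finset.sym_univ, Finset.card_univ,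
    Sym.card_sym_fin_eq_multichoose, Nat.multichoose_eq, symDim, add_comm k d]
  have hd := NeZero.one_le (n := d)
  rw [← Nat.choose_symm (by omega), Nat.sub_right_comm, Nat.add_sub_cancel]

theorem symDim_mul_multinomial_mul_haarMoment (α : Fin d → ℕ) :
    symDim d (∑ i, α i) * Nat.multinomial Finset.univ α * haarMoment α α = 1 := by
  set k := ∑ i, α i
  let s : Finset (Fin d → ℕ) := Finset.piAntidiag Finset.univ k
  calc symDim d k * Nat.multinomial Finset.univ α * haarMoment α α
    _ = ∑ β ∈ s, Nat.multinomial Finset.univ β * haarMoment β β := by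
      have hconst : ∀ β ∈ s,
          Nat.multinomial Finset.univ β * haarMoment β β =
            haarMoment (d := d) (Pi.single 0 k) (Pi.single 0 k) := fun β hβ => by
        rw [multinomial_mul_haarMoment β, (Finset.mem_piAntidiag.mp hβ).1]
      rw [Finset.sum_congr rfl hconst, Finset.sum_const, card_piAntidiag_univ, nsmul_eq_mul,
        mul_assoc, multinomial_mul_haarMoment]
    _ = ∫ U, ∑ β ∈ s,
          Nat.multinomial Finset.univ β * mixedMonomial β β (rotatedKet U) ∂haarUnitary d := by
      simp only [haarMoment]
      rw [integral_finsetSum _ fun β _ => (integrable_mixedMonomial_rotatedKet β β).const_mul _]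
      simp only [integral_const_mul]
    _ = 1 := by
      simp only [s, sum_multinomial_mul_mixedMonomial_self, sum_norm_sq_rotatedKet,
        Complex.ofReal_one, one_pow, integral_const, probReal_univ, one_smul]

theorem succ_mul_symDim_succ (k : ℕ) :
    (k + 1) * symDim d (k + 1) = (k + d) * symDim d k := by
  obtain ⟨m, rfl⟩ := Nat.exists_eq_add_one_of_ne_zero (NeZero.ne d)
  have h := Nat.choose_mul_succ_eq (k + m) m
  rw [show k + m + 1 - m = k + 1 by omega] at h
  rw [symDim, symDim, show k + 1 + (m + 1) - 1 = k + m + 1 by omega,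
    show k + (m + 1) - 1 = k + m by omega, Nat.add_sub_cancel]
  linarith

theorem sum_add_single {ι : Type*} [Fintype ι] [DecidableEq ι] (α : ι → ℕ) (i : ι) :
    ∑ j, (α + Pi.single i 1 : ι → ℕ) j = ∑ j, α j + 1 := by
  simp [Finset.sum_add_distrib]

theorem prod_factorial_add_single {ι : Type*} [Fintype ι] [DecidableEq ι] (α : ι → ℕ) (i : ι) :
    ∏ j, ((α + Pi.single i 1 : ι → ℕ) j).factorial = (α i + 1) * ∏ j, (α j).factorial := by
  rw [Fintype.prod_eq_mul_prod_compl i, Fintype.prod_eq_mul_prod_compl i, ← mul_assoc]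
  congr 1
  · simp [Nat.factorial_succ]
  · exact Finset.prod_congr rfl fun j hj => by simp [show j ≠ i by simpa using hj]

theorem succ_mul_multinomial_add_single {ι : Type*} [Fintype ι] [DecidableEq ι] (α : ι → ℕ)
    (i : ι) :
    (α i + 1) * Nat.multinomial Finset.univ (α + Pi.single i 1) =
      (∑ j, α j + 1) * Nat.multinomial Finset.univ α := by
  have h := Nat.multinomial_spec Finset.univ (α + Pi.single i 1)
  rw [prod_factorial_add_single, sum_add_single, Nat.factorial_succ,
    ← Nat.multinomial_spec Finset.univ α] at h
  refine Nat.eq_of_mul_eq_mul_left (Finset.univ.prod_pos fun j _ => (α j).factorial_pos) ?_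
  linarith

theorem add_mul_haarMoment_add_single (α : Fin d → ℕ) (i : Fin d) :
    ((∑ j, α j : ℕ) + d : ℂ) * haarMoment (α + Pi.single i 1) (α + Pi.single i 1) =
      (α i + 1) * haarMoment α α := by
  have h0 := symDim_mul_multinomial_mul_haarMoment α
  have h1 := symDim_mul_multinomial_mul_haarMoment (α + Pi.single i 1)
  rw [sum_add_single] at h1
  have hdim := congrArg (Nat.cast (R := ℂ)) (succ_mul_symDim_succ (d := d) (∑ j, α j))
  have hmul := congrArg (Nat.cast (R := ℂ)) (succ_mul_multinomial_add_single α i)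
  generalize ∑ j, α j = k at *
  push_cast at hdim hmul
  refine mul_left_cancel₀ (left_ne_zero_of_mul_eq_one h0) ?_
  linear_combination -(Nat.multinomial Finset.univ α : ℂ) *
      haarMoment (α + Pi.single i 1) (α + Pi.single i 1) * hdim -
    symDim d (k + 1) * haarMoment (α + Pi.single i 1) (α + Pi.single i 1) * hmul +
    (α i + 1) * h1 - (α i + 1) * h0

end HaarMoment

section Weight

variable {n d : ℕ}

theorem weight_comp_perm (a : Str n d) (π : Equiv.Perm (Fin n)) : weight (a ∘ π) = weight a := by
  ext i
  exact Finset.card_bijective π π.bijective (by simp)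

theorem sum_weight (a : Str n d) : ∑ i, weight a i = n := by
  have h := Finset.card_eq_sum_card_fiberwise (f := a) (s := Finset.univ) (t := Finset.univ)
    (by simp)
  rw [Finset.card_univ, Fintype.card_fin] at h
  exact h.symm

theorem exists_perm_of_weight_eq {a b : Str n d} (h : weight a = weight b) :
    ∃ π : Equiv.Perm (Fin n), a ∘ π = b := by
  have hfib (i : Fin d) : Nonempty ({s // b s = i} ≃ {s // a s = i}) := by
    refine Fintype.card_eq.mp ?_
    rw [Fintype.card_subtype, Fintype.card_subtype]
    exact (congrFun h i).symm
  exact ⟨Equiv.ofFiberEquiv fun i => (hfib i).some, funext (Equiv.ofFiberEquiv_map _)⟩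

theorem prod_comp_eq_prod_pow_weight {M : Type*} [CommMonoid M] (a : Str n d) (f : Fin d → M) :
    ∏ s, f (a s) = ∏ i, f i ^ weight a i := by
  rw [Finset.prod_comp, Finset.prod_subset (Finset.subset_univ _)]
  · rfl
  · intro i _ hi
    rw [Finset.filter_eq_empty_iff.mpr fun s _ hs => hi (Finset.mem_image.mpr ⟨s, by simp, hs⟩),
      Finset.card_empty, pow_zero]

theorem card_filter_weight_eq {w : Fin d → ℕ} (hw : ∑ i, w i = n) :
    (Finset.univ.filter fun a : Str n d => weight a = w).card = Nat.multinomial Finset.univ w := by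
  -- Compare coefficients in the two expansions of `(∑ i, t i) ^ n`.
  have mem_piAntidiag (v : Fin d → ℕ) :
      v ∈ Finset.piAntidiag Finset.univ n ↔ ∑ i, v i = n := by simp
  refine Nat.cast_injective (R := ℤ) (eq_of_sum_mul_prod_pow_eq (T := Set.univ)
    (s := Finset.piAntidiag Finset.univ n)
    (a := fun v => ((Finset.univ.filter fun a : Str n d => weight a = v).card : ℤ))
    (b := fun v => (Nat.multinomial Finset.univ v : ℤ)) Set.infinite_univ (fun t _ => ?_)
    ((mem_piAntidiag w).mpr hw))
  rw [← Finset.sum_pow_eq_sum_piAntidiag, Fintype.sum_pow, ← Finset.sum_fiberwise_of_maps_to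
    (g := weight) fun a _ => (mem_piAntidiag _).mpr (sum_weight a)]
  refine Finset.sum_congr rfl fun v _ => ?_
  rw [← nsmul_eq_mul, ← Finset.sum_const]
  refine Finset.sum_congr rfl fun a ha => ?_
  rw [prod_comp_eq_prod_pow_weight, (Finset.mem_filter.mp ha).2]

theorem exists_weight_eq {w : Fin d → ℕ} (hw : ∑ i, w i = n) : ∃ a : Str n d, weight a = w := by
  have hpos := Nat.multinomial_pos Finset.univ w
  rw [← card_filter_weight_eq hw, Finset.card_pos] at hpos
  obtain ⟨a, ha⟩ := hpos
  exact ⟨a, (Finset.mem_filter.mp ha).2⟩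

theorem mem_weightSpace_iff {w : Fin d → ℕ} {v : Str n d → ℂ} :
    v ∈ weightSpace w ↔ ∀ a, weight a ≠ w → v a = 0 := by
  constructor
  · intro hv a ha
    refine Submodule.span_induction ?_ rfl (fun x y _ _ hx hy => by simp [hx, hy])
      (fun c x _ hx => by simp [hx]) hv
    rintro _ ⟨b, hb, rfl⟩
    exact Pi.single_eq_of_ne (fun hab : a = b => ha (hab ▸ hb)) _
  · intro hv
    have hsum : v = ∑ a, v a • ket a := by
      ext b
      simp [ket, Finset.sum_apply, Pi.single_apply]
    rw [hsum]
    refine Submodule.sum_mem _ fun a _ => ?_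
    by_cases ha : weight a = w
    · exact Submodule.smul_mem _ _ (Submodule.subset_span ⟨a, ha, rfl⟩)
    · simp [hv a ha]

theorem permOp_mulVec_apply (π : Equiv.Perm (Fin n)) (v : Str n d → ℂ) (b : Str n d) :
    (permOp π *ᵥ v) b = v (b ∘ π) := by
  have h (a : Str n d) : b = a ∘ ⇑π⁻¹ ↔ b ∘ π = a := by
    constructor <;> rintro rfl <;> ext s <;> simp
  simp only [Matrix.mulVec, dotProduct, permOp, Matrix.of_apply, h, ite_mul, one_mul, zero_mul,
    Finset.sum_ite_eq, Finset.mem_univ, if_true]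

theorem permOp_mulVec_ket (π : Equiv.Perm (Fin n)) (a : Str n d) :
    permOp π *ᵥ ket (a ∘ π) = ket a := by
  ext b
  simp [permOp_mulVec_apply, ket, Pi.single_apply, π.surjective.right_cancellable]

theorem span_permOp_mulVec_ket (a : Str n d) :
    Submodule.span ℂ (Set.range fun π : Equiv.Perm (Fin n) => permOp π *ᵥ ket a) =
      weightSpace (weight a) := by
  rw [weightSpace]
  congr 1
  ext v
  constructor
  · rintro ⟨π, rfl⟩
    have h := permOp_mulVec_ket π (a ∘ π.symm)
    rw [Function.comp_assoc, Equiv.symm_comp_self, Function.comp_id] at h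
    exact ⟨a ∘ π.symm, weight_comp_perm a _, h⟩
  · rintro ⟨b, hb, rfl⟩
    obtain ⟨π, rfl⟩ := exists_perm_of_weight_eq hb
    exact ⟨π, permOp_mulVec_ket π b⟩

end Weight

section SingleRow

variable {n d : ℕ}

instance instUniqueSingleLength (hn : 0 < n) : Unique (Fin (Composition.single n hn).length) :=
  inferInstanceAs (Unique (Fin 1))

theorem rowPerms_single (hn : 0 < n) : rowPerms (Composition.single n hn) = Finset.univ :=
  Finset.filter_true_of_mem fun _ _ _ => Subsingleton.elim _ _

theorem coe_invEmbedding_single (hn : 0 < n) (s : Fin n) :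
    ((Composition.single n hn).invEmbedding s : ℕ) = s := by
  rw [Composition.coe_invEmbedding, Subsingleton.elim ((Composition.single n hn).index s) default]
  exact Nat.sub_zero _

theorem colPerms_single (hn : 0 < n) : colPerms (Composition.single n hn) = {1} := by
  ext π
  simp only [colPerms, coe_invEmbedding_single, Finset.mem_filter, Finset.mem_univ, true_and,
    Finset.mem_singleton, Equiv.ext_iff, Fin.ext_iff, Equiv.Perm.one_apply]

theorem permOp_one : permOp (1 : Equiv.Perm (Fin n)) = (1 : Matrix (Str n d) (Str n d) ℂ) := by
  ext a b
  simp [permOp, Matrix.one_apply]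

theorem youngSymmetrizer_single (hn : 0 < n) :
    youngSymmetrizer d (Composition.single n hn) = ∑ π, permOp π := by
  simp [youngSymmetrizer, rowPerms_single, colPerms_single, permOp_one]

theorem permOp_mulVec_youngSymmetrizer_single_mulVec (hn : 0 < n) (π : Equiv.Perm (Fin n))
    (v : Str n d → ℂ) :
    permOp π *ᵥ (youngSymmetrizer d (Composition.single n hn) *ᵥ v) =
      youngSymmetrizer d (Composition.single n hn) *ᵥ v := by
  ext a
  simp only [youngSymmetrizer_single, permOp_mulVec_apply, Matrix.sum_mulVec, Finset.sum_apply]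
  exact Fintype.sum_equiv (Equiv.mulLeft π) _ _ fun σ => rfl

theorem sum_permOp_mulVec {v : Str n d → ℂ} (hv : ∀ π, permOp π *ᵥ v = v) :
    (∑ π, permOp π) *ᵥ v = (n.factorial : ℂ) • v := by
  simp only [Matrix.sum_mulVec, hv, Finset.sum_const, Finset.card_univ, Fintype.card_perm,
    Fintype.card_fin, Nat.cast_smul_eq_nsmul]

theorem trace_one_sub_rowSymProj_mul_pureState (hn : 0 < n) {v : Str n d → ℂ}
    (hv : ∀ π, permOp π *ᵥ v = v) :
    ((1 - rowSymProj d (Composition.single n hn)) * pureState v).trace = 0 := by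
  have hproj : rowSymProj d (Composition.single n hn) *ᵥ v = v := by
    rw [rowSymProj, rowPerms_single, Matrix.smul_mulVec, sum_permOp_mulVec hv, Finset.card_univ,
      Fintype.card_perm, Fintype.card_fin, inv_smul_smul₀ (by exact_mod_cast n.factorial_ne_zero)]
  rw [pureState, Matrix.mul_vecMulVec, Matrix.sub_mulVec, hproj, Matrix.one_mulVec, sub_self,
    Matrix.zero_vecMulVec, Matrix.trace_zero]

/-- The product vector `v^{⊗n}`. -/
def tensorPower (n : ℕ) (v : Fin d → ℂ) : Str n d → ℂ := fun a => ∏ s, v (a s)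

theorem povmElement_single [NeZero d] (hn : 0 < n) (U : Matrix.unitaryGroup (Fin d) ℂ) :
    povmElement (Composition.single n hn) (fun _ => rotatedState d U) =
      (symDim d n : ℂ) • pureState (tensorPower n (rotatedKet U)) := by
  ext a b
  simp only [povmElement, pureState, tensorPower, rotatedState_apply, Matrix.of_apply,
    Matrix.smul_apply, Matrix.vecMulVec_apply, Pi.star_apply, smul_eq_mul, star_prod,
    Finset.prod_mul_distrib, Fintype.prod_unique]
  rfl

theorem trace_pureState_mul_pureState (u v : Str n d → ℂ) :
    (pureState u * pureState v).trace = (star u ⬝ᵥ v) * (u ⬝ᵥ star v) := by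
  rw [pureState, pureState, Matrix.vecMulVec_mul_vecMulVec, Matrix.trace_vecMulVec,
    dotProduct_smul, smul_eq_mul]

theorem pureState_smul {c : ℂ} {v : Str n d → ℂ} (hv : star v ⬝ᵥ v = 1)
    (hcv : star (c • v) ⬝ᵥ (c • v) = 1) : pureState (c • v) = pureState v := by
  rw [star_smul, smul_dotProduct, dotProduct_smul, hv, smul_eq_mul, smul_eq_mul, mul_one] at hcv
  rw [pureState, pureState, star_smul, Matrix.smul_vecMulVec, Matrix.vecMulVec_smul, smul_smul,
    mul_comm, hcv, one_smul]

end SingleRow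

section DickeState

variable {n d : ℕ}

/-- The Dicke state of weight `w`: the symmetric unit vector in the weight subspace `V(w)`, for a
weight `w` with `∑ i, w i = n`. -/
noncomputable def dickeState (n : ℕ) (w : Fin d → ℕ) : Str n d → ℂ :=
  fun a => if weight a = w then ((√(Nat.multinomial Finset.univ w))⁻¹ : ℝ) else 0

theorem star_dickeState (w : Fin d → ℕ) : star (dickeState n w) = dickeState n w := by
  ext a
  rw [Pi.star_apply, dickeState, apply_ite star, star_zero, Complex.star_def, Complex.conj_ofReal]

theorem dickeState_mem_weightSpace (w : Fin d → ℕ) : dickeState n w ∈ weightSpace w :=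
  mem_weightSpace_iff.mpr fun _ ha => if_neg ha

theorem permOp_mulVec_dickeState (π : Equiv.Perm (Fin n)) (w : Fin d → ℕ) :
    permOp π *ᵥ dickeState n w = dickeState n w := by
  ext a
  simp only [permOp_mulVec_apply, dickeState, weight_comp_perm]

theorem dickeState_dotProduct_tensorPower {w : Fin d → ℕ} (hw : ∑ i, w i = n) (v : Fin d → ℂ) :
    dickeState n w ⬝ᵥ tensorPower n v =
      (√(Nat.multinomial Finset.univ w) : ℝ) * ∏ i, v i ^ w i := by
  simp only [dotProduct, dickeState, ite_mul, zero_mul, ← Finset.sum_filter]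
  rw [Finset.sum_congr rfl fun a ha => by
    rw [tensorPower, prod_comp_eq_prod_pow_weight, (Finset.mem_filter.mp ha).2],
    Finset.sum_const, card_filter_weight_eq hw, nsmul_eq_mul, ← mul_assoc,
    ← Complex.ofReal_natCast, ← Complex.ofReal_mul, ← div_eq_mul_inv, Real.div_sqrt]

theorem star_dickeState_dotProduct_self {w : Fin d → ℕ} (hw : ∑ i, w i = n) :
    star (dickeState n w) ⬝ᵥ dickeState n w = 1 := by
  have hpos : (0 : ℝ) < Nat.multinomial Finset.univ w :=
    Nat.cast_pos.mpr (Nat.multinomial_pos _ _)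
  rw [star_dickeState]
  simp only [dotProduct, dickeState, ite_mul, mul_ite, zero_mul, mul_zero, ← Finset.sum_filter,
    Finset.filter_filter, and_self]
  rw [Finset.sum_const, card_filter_weight_eq hw, nsmul_eq_mul, ← Complex.ofReal_natCast,
    ← Complex.ofReal_mul, ← Complex.ofReal_mul, ← mul_inv, Real.mul_self_sqrt hpos.le,
    mul_inv_cancel₀ hpos.ne', Complex.ofReal_one]

theorem exists_eq_smul_dickeState {w : Fin d → ℕ} (hw : ∑ i, w i = n) {v : Str n d → ℂ}
    (hv : v ∈ weightSpace w) (hsymm : ∀ π, permOp π *ᵥ v = v) :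
    ∃ c : ℂ, v = c • dickeState n w := by
  obtain ⟨a, ha⟩ := exists_weight_eq hw
  have hpos : (0 : ℝ) < √(Nat.multinomial Finset.univ w) :=
    Real.sqrt_pos.mpr (Nat.cast_pos.mpr (Nat.multinomial_pos _ _))
  refine ⟨v a * (√(Nat.multinomial Finset.univ w) : ℝ), funext fun b => ?_⟩
  by_cases hb : weight b = w
  · obtain ⟨π, rfl⟩ := exists_perm_of_weight_eq (ha.trans hb.symm)
    rw [Pi.smul_apply, dickeState, if_pos hb, smul_eq_mul, mul_assoc, ← Complex.ofReal_mul,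
      mul_inv_cancel₀ hpos.ne', Complex.ofReal_one, mul_one, ← permOp_mulVec_apply π v a, hsymm]
  · rw [Pi.smul_apply, dickeState, if_neg hb, smul_zero, mem_weightSpace_iff.mp hv b hb]

theorem IsSchurVector.pureState_eq {hn : 0 < n} {τ : Str n d → ℂ}
    (hτ : IsSchurVector (Composition.single n hn) τ) {w : Fin d → ℕ} (hw : ∑ i, w i = n)
    (hmem : τ ∈ weightSpace w) : pureState τ = pureState (dickeState n w) := by
  obtain ⟨⟨_, v, -, rfl⟩, hunit⟩ := hτ
  obtain ⟨c, hc⟩ := exists_eq_smul_dickeState hw hmem fun π =>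
    permOp_mulVec_youngSymmetrizer_single_mulVec hn π v
  rw [hc] at hunit ⊢
  exact pureState_smul (star_dickeState_dotProduct_self hw) hunit

theorem isSchurVector_dickeState (hn : 0 < n) {w : Fin d → ℕ} (hw : ∑ i, w i = n) :
    IsSchurVector (Composition.single n hn) (dickeState n w) := by
  refine ⟨⟨w, (n.factorial : ℂ)⁻¹ • dickeState n w,
    Submodule.smul_mem _ _ (dickeState_mem_weightSpace w), ?_⟩, star_dickeState_dotProduct_self hw⟩
  rw [youngSymmetrizer_single, Matrix.mulVec_smul,
    sum_permOp_mulVec fun π => permOp_mulVec_dickeState π w,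
    inv_smul_smul₀ (by exact_mod_cast n.factorial_ne_zero)]

theorem trace_povmElement_single_mul_pureState_dickeState [NeZero d] (hn : 0 < n) {w : Fin d → ℕ}
    (hw : ∑ i, w i = n) (U : Matrix.unitaryGroup (Fin d) ℂ) :
    (povmElement (Composition.single n hn) (fun _ => rotatedState d U) *
        pureState (dickeState n w)).trace =
      symDim d n * Nat.multinomial Finset.univ w * mixedMonomial w w (rotatedKet U) := by
  have hmono : mixedMonomial w w (rotatedKet U) =
      (∏ i, rotatedKet U i ^ w i) * star (∏ i, rotatedKet U i ^ w i) := by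
    simp only [mixedMonomial, Finset.prod_mul_distrib, star_prod, star_pow]
  have hsqrt : ((√(Nat.multinomial Finset.univ w) : ℝ) : ℂ) * (√(Nat.multinomial Finset.univ w) : ℝ)
      = Nat.multinomial Finset.univ w := by
    rw [← Complex.ofReal_mul, Real.mul_self_sqrt (Nat.cast_nonneg _), Complex.ofReal_natCast]
  have hinner : star (tensorPower n (rotatedKet U)) ⬝ᵥ dickeState n w =
      star (dickeState n w ⬝ᵥ tensorPower n (rotatedKet U)) := by
    rw [Matrix.star_dotProduct, star_dickeState]
  rw [povmElement_single, Matrix.smul_mul, Matrix.trace_smul, trace_pureState_mul_pureState, hinner,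
    star_dickeState, dotProduct_comm _ (dickeState n w), dickeState_dotProduct_tensorPower hw,
    hmono, ← hsqrt, star_mul', Complex.star_def, Complex.conj_ofReal, smul_eq_mul]
  ring

end DickeState

section PairWeight

variable {n d : ℕ} [NeZero d]

/-- The weight of `|0⟩^{⊗p} |1⟩^{⊗q}`. -/
def pairWeight (d p q : ℕ) [NeZero d] : Fin d → ℕ := Pi.single 0 p + Pi.single 1 q

theorem sum_pairWeight (p q : ℕ) : ∑ i, pairWeight d p q i = p + q := by
  simp [pairWeight, Finset.sum_add_distrib]

theorem zero_ne_one_of_two_le (hd : 2 ≤ d) : (0 : Fin d) ≠ 1 := by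
  obtain ⟨k, rfl⟩ := Nat.exists_eq_add_of_le' hd
  simp

theorem weight_stepString (hd : 2 ≤ d) {p q : ℕ} (hpq : p + q = n) :
    weight (stepString n d p) = pairWeight d p q := by
  have h01 := zero_ne_one_of_two_le hd
  have hlt : (Finset.univ.filter fun s : Fin n => (s : ℕ) < p).card = p := by
    simp [Fin.card_filter_val_lt, ← hpq]
  have hge : (Finset.univ.filter fun s : Fin n => ¬ (s : ℕ) < p).card = q := by
    have := Finset.card_filter_add_card_filter_not (s := Finset.univ) fun s : Fin n => (s : ℕ) < p
    rw [hlt, Finset.card_univ, Fintype.card_fin] at this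
    omega
  ext i
  rcases eq_or_ne i 0 with rfl | h0
  · simpa [weight, stepString, pairWeight, ite_eq_iff, h01, h01.symm] using hlt
  · rcases eq_or_ne i 1 with rfl | h1
    · simpa [weight, stepString, pairWeight, ite_eq_iff, h01, h01.symm] using hge
    · simp [weight, stepString, pairWeight, ite_eq_iff, h0, h1, h0.symm, h1.symm]

variable {p q : ℕ} {O : Matrix (Fin d) (Fin d) ℂ}

theorem Setup.pureState_eq {hn : 0 < n} {τ : Str n d → ℂ} (h : Setup n hn d p q τ O) :
    pureState τ = pureState (dickeState n (pairWeight d p q)) := by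
  refine h.schur.pureState_eq ((sum_pairWeight p q).trans h.add_eq) ?_
  rw [← weight_stepString h.two_le h.add_eq, ← span_permOp_mulVec_ket]
  exact h.mem_span

theorem setup_dickeState (hn : 0 < n) (hd : 2 ≤ d) (hpq : p + q = n) (hO : O.IsHermitian)
    (htr : O.trace = 0) : Setup n hn d p q (dickeState n (pairWeight d p q)) O where
  two_le := hd
  add_eq := hpq
  schur := isSchurVector_dickeState hn ((sum_pairWeight p q).trans hpq)
  mem_span := by
    rw [span_permOp_mulVec_ket, weight_stepString hd hpq]
    exact dickeState_mem_weightSpace _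
  hermitian := hO
  traceless := htr

end PairWeight

section BornLaw

variable {d : ℕ} [NeZero d]

/-- The density of the Born rule for the Dicke state of weight `w`, with respect to the Haar measure
on the unitaries `U` that yield the outcome `U |0⟩⟨0| U†`. -/
noncomputable def bornDensity (w : Fin d → ℕ) (U : Matrix.unitaryGroup (Fin d) ℂ) : ℝ :=
  symDim d (∑ i, w i) * Nat.multinomial Finset.univ w * ∏ i, (‖rotatedKet U i‖ ^ 2) ^ w i

theorem ofReal_bornDensity (w : Fin d → ℕ) (U : Matrix.unitaryGroup (Fin d) ℂ) :
    (bornDensity w U : ℂ) = symDim d (∑ i, w i) * Nat.multinomial Finset.univ w *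
      mixedMonomial w w (rotatedKet U) := by
  rw [bornDensity, mixedMonomial_self]
  push_cast
  rfl

theorem bornDensity_nonneg (w : Fin d → ℕ) (U : Matrix.unitaryGroup (Fin d) ℂ) :
    0 ≤ bornDensity w U := by
  unfold bornDensity
  positivity

theorem continuous_bornDensity (w : Fin d → ℕ) : Continuous (bornDensity w) := by
  unfold bornDensity
  fun_prop

/-- The law of a unitary `U` that yields the outcome `U |0⟩⟨0| U†`, for the Dicke state of weight
`w`. -/
noncomputable def bornLaw (w : Fin d → ℕ) : Measure (Matrix.unitaryGroup (Fin d) ℂ) :=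
  (haarUnitary d).withDensity fun U => ENNReal.ofReal (bornDensity w U)

theorem integral_mixedMonomial_bornLaw (w α β : Fin d → ℕ) :
    ∫ U, mixedMonomial α β (rotatedKet U) ∂bornLaw w =
      symDim d (∑ i, w i) * Nat.multinomial Finset.univ w * haarMoment (w + α) (w + β) := by
  rw [bornLaw, integral_withDensity_eq_integral_toReal_smul
    (continuous_bornDensity w).measurable.ennreal_ofReal
    (ae_of_all _ fun _ => ENNReal.ofReal_lt_top), haarMoment, ← integral_const_mul]
  congr 1
  ext U
  rw [ENNReal.toReal_ofReal (bornDensity_nonneg w U), Complex.real_smul, ofReal_bornDensity,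
    mixedMonomial_add, mul_assoc]

instance instIsProbabilityMeasureBornLaw (w : Fin d → ℕ) : IsProbabilityMeasure (bornLaw w) := by
  have hmass : ∫ U, bornDensity w U ∂haarUnitary d = 1 := by
    apply Complex.ofReal_injective
    rw [← integral_complex_ofReal, Complex.ofReal_one, ← symDim_mul_multinomial_mul_haarMoment w,
      haarMoment, ← integral_const_mul]
    simp only [ofReal_bornDensity]
  refine ⟨?_⟩
  rw [bornLaw, withDensity_apply _ MeasurableSet.univ, Measure.restrict_univ,
    ← ofReal_integral_eq_lintegral_ofReal
      (integrable_haarUnitary_of_continuous (continuous_bornDensity w))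
      (ae_of_all _ (bornDensity_nonneg w)), hmass, ENNReal.ofReal_one]

theorem memLp_bornLaw_of_continuous {E : Type*} [NormedAddCommGroup E] (w : Fin d → ℕ)
    {f : Matrix.unitaryGroup (Fin d) ℂ → E} (hf : Continuous f) (r : ENNReal) :
    MemLp f r (bornLaw w) :=
  hf.memLp_of_hasCompactSupport (HasCompactSupport.of_compactSpace f)

@[fun_prop]
theorem continuous_rotatedState : Continuous (rotatedState d) :=
  continuous_matrix fun i j => by
    simp only [rotatedState_apply]
    fun_prop

/-- The mean of the outcome for the Dicke state of weight `w`, scaled by `d + ∑ i, w i`. -/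
def scaledMean (w : Fin d → ℕ) : Matrix (Fin d) (Fin d) ℂ :=
  Matrix.diagonal fun i => w i + 1

theorem add_mul_haarMoment_add_single_add_single (w : Fin d → ℕ) (i k : Fin d) :
    ((∑ m, w m : ℕ) + d : ℂ) * ((∑ m, w m : ℕ) + d + 1) *
        haarMoment (w + (Pi.single i 1 + Pi.single k 1)) (w + (Pi.single i 1 + Pi.single k 1)) =
      (w i + 1) * (w k + 1 + if i = k then 1 else 0) * haarMoment w w := by
  have h1 := add_mul_haarMoment_add_single w i
  have h2 := add_mul_haarMoment_add_single (w + Pi.single i 1) k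
  have hk : (((w + Pi.single i 1 : Fin d → ℕ) k : ℕ) : ℂ) = w k + if i = k then 1 else 0 := by
    simp [Pi.single_apply, eq_comm]
  rw [sum_add_single, hk, add_assoc w] at h2
  push_cast at h1 h2 ⊢
  linear_combination (∑ m, (w m : ℂ) + d) * h2 + (w k + 1 + if i = k then 1 else 0) * h1

theorem add_mul_haarMoment_add_single_single (w : Fin d → ℕ) (i j : Fin d) :
    ((∑ m, w m : ℕ) + d : ℂ) * haarMoment (w + Pi.single i 1) (w + Pi.single j 1) =
      scaledMean w i j * haarMoment w w := by
  rcases eq_or_ne i j with rfl | hij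
  · rw [add_mul_haarMoment_add_single, scaledMean, Matrix.diagonal_apply_eq]
  · have hsingle : (Pi.single i 1 : Fin d → ℕ) ≠ Pi.single j 1 := fun h => by
      simpa [hij] using congrFun h i
    rw [haarMoment_eq_zero_of_ne fun h => hsingle (add_left_cancel h), scaledMean,
      Matrix.diagonal_apply_ne _ hij, mul_zero, zero_mul]

theorem add_mul_haarMoment_bidegree_two (w : Fin d → ℕ) (i j k l : Fin d) :
    ((∑ m, w m : ℕ) + d : ℂ) * ((∑ m, w m : ℕ) + d + 1) *
        haarMoment (w + (Pi.single i 1 + Pi.single k 1)) (w + (Pi.single j 1 + Pi.single l 1)) =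
      (scaledMean w i j * scaledMean w k l + scaledMean w i l * scaledMean w k j -
        if i = j ∧ i = k ∧ i = l then (w i : ℂ) * (w i + 1) else 0) * haarMoment w w := by
  have hiff := Pi.single_add_single_eq_single_add_single (k := i) (l := k) (m := j) (n := l)
    (one_ne_zero (α := ℕ)) one_ne_zero
  simp only [scaledMean, Matrix.diagonal_apply]
  by_cases h : (Pi.single i 1 + Pi.single k 1 : Fin d → ℕ) = Pi.single j 1 + Pi.single l 1
  · rw [← h, add_mul_haarMoment_add_single_add_single]
    congr 1
    rcases hiff.mp h with ⟨rfl, rfl⟩ | ⟨-, rfl, rfl⟩ | ⟨h2, -, -⟩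
    · split_ifs <;> grind
    · split_ifs <;> grind
    · exact absurd h2 two_ne_zero
  · rw [haarMoment_eq_zero_of_ne fun h' => h (add_left_cancel h'), mul_zero, zero_eq_mul]
    left
    split_ifs <;> grind

theorem add_mul_integral_rotatedState_apply (w : Fin d → ℕ) (i j : Fin d) :
    ((∑ m, w m : ℕ) + d : ℂ) * ∫ U, rotatedState d U i j ∂bornLaw w = scaledMean w i j := by
  have hmono (U : Matrix.unitaryGroup (Fin d) ℂ) : rotatedState d U i j =
      mixedMonomial (Pi.single i 1) (Pi.single j 1) (rotatedKet U) := by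
    rw [rotatedState_apply, mixedMonomial_single, pow_one, pow_one]
  simp only [hmono, integral_mixedMonomial_bornLaw]
  linear_combination (symDim d (∑ i, w i) * Nat.multinomial Finset.univ w : ℂ) *
    add_mul_haarMoment_add_single_single w i j +
      scaledMean w i j * symDim_mul_multinomial_mul_haarMoment w

theorem add_mul_integral_rotatedState_apply_mul (w : Fin d → ℕ) (i j k l : Fin d) :
    ((∑ m, w m : ℕ) + d : ℂ) * ((∑ m, w m : ℕ) + d + 1) *
        ∫ U, rotatedState d U i j * rotatedState d U k l ∂bornLaw w =
      scaledMean w i j * scaledMean w k l + scaledMean w i l * scaledMean w k j -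
        if i = j ∧ i = k ∧ i = l then (w i : ℂ) * (w i + 1) else 0 := by
  have hmono (U : Matrix.unitaryGroup (Fin d) ℂ) : rotatedState d U i j * rotatedState d U k l =
      mixedMonomial (Pi.single i 1 + Pi.single k 1) (Pi.single j 1 + Pi.single l 1)
        (rotatedKet U) := by
    simp only [mixedMonomial_add, mixedMonomial_single, rotatedState_apply, pow_one]
  simp only [hmono, integral_mixedMonomial_bornLaw]
  linear_combination (symDim d (∑ i, w i) * Nat.multinomial Finset.univ w : ℂ) *
    add_mul_haarMoment_bidegree_two w i j k l +
      (scaledMean w i j * scaledMean w k l + scaledMean w i l * scaledMean w k j -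
        if i = j ∧ i = k ∧ i = l then (w i : ℂ) * (w i + 1) else 0) *
        symDim_mul_multinomial_mul_haarMoment w

end BornLaw

section OutcomeLaw

variable {n d : ℕ}

theorem map_withDensity_comp {X Y : Type*} [MeasurableSpace X] [MeasurableSpace Y]
    (μ : Measure X) {f : X → Y} (hf : Measurable f) {g : Y → ENNReal} (hg : Measurable g) :
    (μ.map f).withDensity g = (μ.withDensity (g ∘ f)).map f := by
  ext s hs
  rw [withDensity_apply _ hs, Measure.map_apply hf hs, withDensity_apply _ (hf hs),
    setLIntegral_map hs hg hf]
  rfl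

theorem measurable_matrix_apply {ι : Type*} (k : ι) (i j : Fin d) :
    Measurable fun ψ : ι → Matrix (Fin d) (Fin d) ℂ => ψ k i j :=
  (measurable_pi_apply j).comp ((measurable_pi_apply i).comp (measurable_pi_apply k))

theorem measurable_trace_povmElement_mul (lam : Composition n) (ρ : Matrix (Str n d) (Str n d) ℂ) :
    Measurable fun ψ => (povmElement lam ψ * ρ).trace := by
  simp only [Matrix.trace, Matrix.diag_apply, Matrix.mul_apply, povmElement, Matrix.of_apply]
  refine Finset.measurable_sum _ fun a _ => Finset.measurable_sum _ fun b _ => ?_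
  refine ((Finset.measurable_prod _ fun s _ => ?_).const_mul _).mul_const _
  exact measurable_matrix_apply _ _ _

theorem measurable_estimate (lam : Composition n) (O : Matrix (Fin d) (Fin d) ℂ) :
    Measurable (estimate lam O) := by
  refine measurable_fun_sum (Complex.measurable_re.comp ?_) (measurable_of_finite _)
  simp only [shadow, Matrix.trace, Matrix.diag_apply, Matrix.mul_apply, Matrix.sum_apply,
    Matrix.smul_apply, smul_eq_mul]
  refine Finset.measurable_sum _ fun a _ => Finset.measurable_sum _ fun b _ => ?_
  refine (Finset.measurable_sum _ fun i _ => ?_).const_mul _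
  exact (measurable_matrix_apply _ _ _).const_mul _

variable [NeZero d]

instance instIsProbabilityMeasureHaarState : IsProbabilityMeasure (haarState d) :=
  Measure.isProbabilityMeasure_map continuous_rotatedState.aemeasurable

theorem measurable_const_rotatedState (ι : Type*) :
    Measurable fun (U : Matrix.unitaryGroup (Fin d) ℂ) (_ : ι) => rotatedState d U :=
  measurable_pi_lambda _ fun _ => continuous_rotatedState.measurable

theorem pi_haarState_of_unique {ι : Type*} [Fintype ι] [Unique ι] :
    Measure.pi (fun _ : ι => haarState d) = (haarUnitary d).map fun U _ => rotatedState d U := by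
  refine Measure.pi_eq fun s hs => ?_
  rw [Measure.map_apply (measurable_const_rotatedState ι) (.univ_pi hs), Fintype.prod_unique,
    haarState, Measure.map_apply continuous_rotatedState.measurable (hs _)]
  congr 1
  ext U
  simp [Unique.forall_iff]

/-- The outcome `U |0⟩⟨0| U†` of the measurement for the partition `(n)`. -/
noncomputable def rotatedOutcome (hn : 0 < n) (U : Matrix.unitaryGroup (Fin d) ℂ) :
    Outcome d (Composition.single n hn) :=
  Sum.inl fun _ => rotatedState d U

theorem measurable_rotatedOutcome (hn : 0 < n) : Measurable (rotatedOutcome (d := d) hn) :=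
  measurable_inl.comp (measurable_const_rotatedState _)

theorem outcomeLaw_dickeState (hn : 0 < n) {w : Fin d → ℕ} (hw : ∑ i, w i = n) :
    outcomeLaw d (Composition.single n hn) (pureState (dickeState n w)) =
      (bornLaw w).map (rotatedOutcome hn) := by
  have hmeas : Measurable fun ψ => ENNReal.ofReal
      (povmElement (Composition.single n hn) ψ * pureState (dickeState n w)).trace.re :=
    (Complex.measurable_re.comp (measurable_trace_povmElement_mul _ _)).ennreal_ofReal
  have hborn (U : Matrix.unitaryGroup (Fin d) ℂ) :
      (povmElement (Composition.single n hn) (fun _ => rotatedState d U) *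
        pureState (dickeState n w)).trace.re = bornDensity w U := by
    rw [trace_povmElement_single_mul_pureState_dickeState hn hw,
      ← Complex.ofReal_re (bornDensity w U), ofReal_bornDensity, hw]
  rw [outcomeLaw, trace_one_sub_rowSymProj_mul_pureState hn fun π => permOp_mulVec_dickeState π w,
    Complex.zero_re, ENNReal.ofReal_zero, zero_smul, add_zero, pi_haarState_of_unique,
    map_withDensity_comp _ (measurable_const_rotatedState _) hmeas,
    Measure.map_map measurable_inl (measurable_const_rotatedState _)]
  simp only [Function.comp_def, hborn]
  rfl

theorem estimate_rotatedOutcome (hn : 0 < n) (O : Matrix (Fin d) (Fin d) ℂ)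
    (U : Matrix.unitaryGroup (Fin d) ℂ) :
    estimate (Composition.single n hn) O (rotatedOutcome hn U) =
      (n + d : ℝ) * (O * rotatedState d U).trace.re := by
  have hshadow : shadow (Composition.single n hn) (rotatedOutcome hn U) =
      ((n + d : ℝ) : ℂ) • rotatedState d U := by
    rw [rotatedOutcome, shadow, Fintype.sum_unique, add_comm (n : ℝ)]
    push_cast
    rfl
  rw [estimate, hshadow, Matrix.mul_smul, Matrix.trace_smul, smul_eq_mul, Complex.re_ofReal_mul]

theorem memLp_trace_mul_rotatedState (O : Matrix (Fin d) (Fin d) ℂ) (w : Fin d → ℕ) :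
    MemLp (fun U => (O * rotatedState d U).trace.re) 2 (bornLaw w) :=
  memLp_bornLaw_of_continuous w (by fun_prop) 2

theorem isProbabilityMeasure_outcomeLaw_dickeState (hn : 0 < n) {w : Fin d → ℕ}
    (hw : ∑ i, w i = n) :
    IsProbabilityMeasure
      (outcomeLaw d (Composition.single n hn) (pureState (dickeState n w))) := by
  rw [outcomeLaw_dickeState hn hw]
  exact Measure.isProbabilityMeasure_map (measurable_rotatedOutcome hn).aemeasurable

theorem memLp_estimate_outcomeLaw_dickeState (hn : 0 < n) {w : Fin d → ℕ} (hw : ∑ i, w i = n)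
    (O : Matrix (Fin d) (Fin d) ℂ) :
    MemLp (estimate (Composition.single n hn) O) 2
      (outcomeLaw d (Composition.single n hn) (pureState (dickeState n w))) := by
  rw [outcomeLaw_dickeState hn hw, memLp_map_measure_iff
    (measurable_estimate _ _).aestronglyMeasurable (measurable_rotatedOutcome hn).aemeasurable]
  refine ((memLp_trace_mul_rotatedState O w).const_mul (n + d : ℝ)).ae_eq (ae_of_all _ fun U => ?_)
  exact (estimate_rotatedOutcome hn O U).symm

theorem estimateVar_dickeState_eq_variance (hn : 0 < n) {w : Fin d → ℕ} (hw : ∑ i, w i = n)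
    (O : Matrix (Fin d) (Fin d) ℂ) :
    estimateVar (Composition.single n hn) (dickeState n w) O =
      (n + d : ℝ) ^ 2 * variance (fun U => (O * rotatedState d U).trace.re) (bornLaw w) := by
  rw [estimateVar, outcomeLaw_dickeState hn hw, variance_map (measurable_estimate _ _).aemeasurable
    (measurable_rotatedOutcome hn).aemeasurable, ← variance_const_mul]
  congr 1
  exact funext (estimate_rotatedOutcome hn O)

end OutcomeLaw

section Variance

variable {n d : ℕ}

theorem trace_mul_eq_sum_prod {m R : Type*} [Fintype m] [NonUnitalNonAssocSemiring R]
    (A B : Matrix m m R) : (A * B).trace = ∑ x : m × m, A x.1 x.2 * B x.2 x.1 := by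
  simp only [Matrix.trace, Matrix.diag_apply, Matrix.mul_apply, Fintype.sum_prod_type]

theorem trace_sq_mul_eq_sum {m R : Type*} [Fintype m] [DecidableEq m] [CommSemiring R]
    (A B : Matrix m m R) : ((A * B) ^ 2).trace =
      ∑ x : m × m, ∑ y : m × m, A x.1 x.2 * A y.1 y.2 * (B x.2 y.1 * B y.2 x.1) := by
  simp only [sq (A * B), trace_mul_eq_sum_prod, Matrix.mul_apply, Finset.sum_mul_sum,
    Fintype.sum_prod_type, mul_mul_mul_comm]
  exact Finset.sum_congr rfl fun i _ => Finset.sum_comm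

theorem sum_mul_apply_self_sq_eq_sum {m R : Type*} [Fintype m] [DecidableEq m] [CommSemiring R]
    (A : Matrix m m R) (c : m → R) : ∑ i, c i * A i i ^ 2 =
      ∑ x : m × m, ∑ y : m × m,
        A x.1 x.2 * A y.1 y.2 * if x.2 = x.1 ∧ x.2 = y.2 ∧ x.2 = y.1 then c x.2 else 0 := by
  simp only [Fintype.sum_prod_type, ite_and, mul_ite, mul_zero]
  refine Finset.sum_congr rfl fun i _ => ?_
  rw [Finset.sum_eq_single_of_mem i (Finset.mem_univ i) fun j _ hj => by simp [hj]]
  simp [sq, mul_comm]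

theorem ofReal_re_trace_mul {m : Type*} [Fintype m] {A B : Matrix m m ℂ} (hA : A.IsHermitian)
    (hB : B.IsHermitian) : ((A * B).trace.re : ℂ) = (A * B).trace := by
  refine Complex.conj_eq_iff_re.mp ?_
  rw [starRingEnd_apply, ← Matrix.trace_conjTranspose, Matrix.conjTranspose_mul, hA.eq, hB.eq,
    Matrix.trace_mul_comm]

variable [NeZero d]

theorem isHermitian_rotatedState (U : Matrix.unitaryGroup (Fin d) ℂ) :
    (rotatedState d U).IsHermitian := by
  ext i j
  simp [rotatedState_apply, mul_comm]

theorem add_mul_integral_trace_mul_rotatedState (O : Matrix (Fin d) (Fin d) ℂ) (w : Fin d → ℕ) :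
    ((∑ m, w m : ℕ) + d : ℂ) * ∫ U, (O * rotatedState d U).trace ∂bornLaw w =
      (O * scaledMean w).trace := by
  have hint (i j : Fin d) : Integrable (fun U => O i j * rotatedState d U j i) (bornLaw w) :=
    memLp_one_iff_integrable.mp (memLp_bornLaw_of_continuous w (by fun_prop) 1)
  simp only [trace_mul_eq_sum_prod]
  rw [integral_finsetSum _ fun x _ => hint x.1 x.2, Finset.mul_sum]
  refine Finset.sum_congr rfl fun x _ => ?_
  rw [integral_const_mul, mul_left_comm, add_mul_integral_rotatedState_apply]

theorem add_mul_integral_sq_trace_mul_rotatedState (O : Matrix (Fin d) (Fin d) ℂ)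
    (w : Fin d → ℕ) :
    ((∑ m, w m : ℕ) + d : ℂ) * ((∑ m, w m : ℕ) + d + 1) *
        ∫ U, (O * rotatedState d U).trace ^ 2 ∂bornLaw w =
      (O * scaledMean w).trace ^ 2 + ((O * scaledMean w) ^ 2).trace -
        ∑ i, (w i : ℂ) * (w i + 1) * O i i ^ 2 := by
  have hint (i j k l : Fin d) : Integrable (fun U =>
      O i j * O k l * (rotatedState d U j i * rotatedState d U l k)) (bornLaw w) :=
    memLp_one_iff_integrable.mp (memLp_bornLaw_of_continuous w (by fun_prop) 1)
  have hsq (ρ : Matrix (Fin d) (Fin d) ℂ) : (O * ρ).trace ^ 2 =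
      ∑ x : Fin d × Fin d, ∑ y : Fin d × Fin d,
        O x.1 x.2 * O y.1 y.2 * (ρ x.2 x.1 * ρ y.2 y.1) := by
    simp only [sq, trace_mul_eq_sum_prod, Finset.sum_mul_sum, mul_mul_mul_comm]
  simp only [hsq, trace_sq_mul_eq_sum, sum_mul_apply_self_sq_eq_sum O, ← Finset.sum_add_distrib,
    ← Finset.sum_sub_distrib]
  rw [integral_finsetSum _ fun x _ => integrable_finsetSum _ fun y _ => hint _ _ _ _,
    Finset.mul_sum]
  refine Finset.sum_congr rfl fun x _ => ?_
  rw [integral_finsetSum _ fun y _ => hint _ _ _ _, Finset.mul_sum]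
  refine Finset.sum_congr rfl fun y _ => ?_
  rw [integral_const_mul, mul_left_comm, add_mul_integral_rotatedState_apply_mul]
  ring

theorem add_one_mul_estimateVar_dickeState (hn : 0 < n) {w : Fin d → ℕ} (hw : ∑ i, w i = n)
    {O : Matrix (Fin d) (Fin d) ℂ} (hO : O.IsHermitian) :
    (n + d + 1 : ℂ) * estimateVar (Composition.single n hn) (dickeState n w) O =
      (n + d) * (((O * scaledMean w) ^ 2).trace - ∑ i, (w i : ℂ) * (w i + 1) * O i i ^ 2) -
        (O * scaledMean w).trace ^ 2 := by
  have hmean := add_mul_integral_trace_mul_rotatedState O w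
  have hsq := add_mul_integral_sq_trace_mul_rotatedState O w
  rw [hw] at hmean hsq
  rw [estimateVar_dickeState_eq_variance hn hw, variance_eq_sub (memLp_trace_mul_rotatedState O w)]
  simp only [Pi.pow_apply, Complex.ofReal_mul, Complex.ofReal_sub, Complex.ofReal_pow,
    Complex.ofReal_add, Complex.ofReal_natCast, ← integral_complex_ofReal,
    ofReal_re_trace_mul hO (isHermitian_rotatedState _)]
  rw [← hmean] at hsq ⊢
  linear_combination (n + d : ℂ) * hsq

end Variance

section TwoLevels

variable {d : ℕ} [NeZero d]

theorem scaledMean_pairWeight (p q : ℕ) :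
    scaledMean (pairWeight d p q) =
      1 + (p : ℂ) • Matrix.single 0 0 1 + (q : ℂ) • Matrix.single 1 1 1 := by
  rw [scaledMean, Matrix.smul_single, Matrix.smul_single, ← Matrix.diagonal_single,
    ← Matrix.diagonal_single, ← Matrix.diagonal_one, Matrix.diagonal_add, Matrix.diagonal_add]
  congr 1
  ext i
  simp [pairWeight, Pi.single_apply]
  ring

theorem trace_mul_scaledMean_pairWeight (O : Matrix (Fin d) (Fin d) ℂ) (p q : ℕ) :
    (O * scaledMean (pairWeight d p q)).trace = O.trace + p * O 0 0 + q * O 1 1 := by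
  simp [scaledMean_pairWeight, mul_add, Matrix.trace_mul_single, mul_comm]

theorem trace_sq_mul_scaledMean_pairWeight (O : Matrix (Fin d) (Fin d) ℂ) (p q : ℕ) :
    ((O * scaledMean (pairWeight d p q)) ^ 2).trace =
      (O ^ 2).trace + 2 * p * (O ^ 2) 0 0 + 2 * q * (O ^ 2) 1 1 + 2 * p * q * (O 0 1 * O 1 0) +
        p ^ 2 * O 0 0 ^ 2 + q ^ 2 * O 1 1 ^ 2 := by
  have hleft (i : Fin d) : (O * (O * Matrix.single i i 1)).trace = (O ^ 2) i i := by
    rw [← mul_assoc, ← sq, Matrix.trace_mul_single]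
    simp
  have hright (i : Fin d) : (O * Matrix.single i i 1 * O).trace = (O ^ 2) i i := by
    rw [Matrix.trace_mul_comm, hleft]
  have hboth (i j : Fin d) :
      (O * Matrix.single i i 1 * (O * Matrix.single j j 1)).trace = O i j * O j i := by
    rw [← mul_assoc, Matrix.trace_mul_single]
    simp [Matrix.mul_apply, Matrix.single_apply, ite_and, mul_comm]
  rw [scaledMean_pairWeight, sq (O * _)]
  simp only [mul_add, add_mul, mul_one, mul_smul_comm,
    smul_mul_assoc, Matrix.trace_add, Matrix.trace_smul, hleft, hright, hboth, smul_eq_mul]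
  rw [← sq O]
  ring

theorem sum_pairWeight_mul_apply_self_sq (hd : 2 ≤ d) (O : Matrix (Fin d) (Fin d) ℂ) (p q : ℕ) :
    ∑ i, (pairWeight d p q i : ℂ) * (pairWeight d p q i + 1) * O i i ^ 2 =
      p * (p + 1) * O 0 0 ^ 2 + q * (q + 1) * O 1 1 ^ 2 := by
  have h01 := zero_ne_one_of_two_le hd
  rw [← Finset.sum_subset (Finset.subset_univ {0, 1}) fun i _ hi => ?_, Finset.sum_pair h01]
  · simp [pairWeight, h01, h01.symm]
  · simp_all [pairWeight]

end TwoLevels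

section Hermitian

variable {m : Type*} {A : Matrix m m ℂ}

theorem mul_apply_swap_eq_sq_norm (hA : A.IsHermitian) (i j : m) :
    A i j * A j i = ((‖A i j‖ ^ 2 : ℝ) : ℂ) := by
  rw [← hA.apply j i, ← Complex.normSq_eq_norm_sq, ← Complex.mul_conj, starRingEnd_apply]

variable [Fintype m] [DecidableEq m]

theorem sq_norm_apply_le_re_sq_apply_self (hA : A.IsHermitian) (i j : m) :
    ‖A i j‖ ^ 2 ≤ ((A ^ 2) i i).re := by
  simp only [sq A, Matrix.mul_apply, Complex.re_sum, mul_apply_swap_eq_sq_norm hA,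
    Complex.ofReal_re]
  exact Finset.single_le_sum (f := fun j => ‖A i j‖ ^ 2) (fun _ _ => sq_nonneg _)
    (Finset.mem_univ j)

theorem re_trace_sq_nonneg (hA : A.IsHermitian) : 0 ≤ (A ^ 2).trace.re := by
  rw [Matrix.trace, Complex.re_sum]
  exact Finset.sum_nonneg fun i _ =>
    (sq_nonneg _).trans (sq_norm_apply_le_re_sq_apply_self hA i i)

end Hermitian

section OneRow

variable {n d : ℕ} [NeZero d] {hn : 0 < n} {p q : ℕ} {τ : Str n d → ℂ}
  {O : Matrix (Fin d) (Fin d) ℂ}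

theorem Setup.isProbabilityMeasure_outcomeLaw (h : Setup n hn d p q τ O) :
    IsProbabilityMeasure (outcomeLaw d (Composition.single n hn) (pureState τ)) := by
  rw [h.pureState_eq]
  exact isProbabilityMeasure_outcomeLaw_dickeState hn ((sum_pairWeight p q).trans h.add_eq)

theorem Setup.memLp_estimate (h : Setup n hn d p q τ O) :
    MemLp (estimate (Composition.single n hn) O) 2
      (outcomeLaw d (Composition.single n hn) (pureState τ)) := by
  rw [h.pureState_eq]
  exact memLp_estimate_outcomeLaw_dickeState hn ((sum_pairWeight p q).trans h.add_eq) O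

theorem Setup.estimateVar_eq_dickeState (h : Setup n hn d p q τ O) :
    estimateVar (Composition.single n hn) τ O =
      estimateVar (Composition.single n hn) (dickeState n (pairWeight d p q)) O := by
  rw [estimateVar, h.pureState_eq, estimateVar]

theorem Setup.estimateVar_eq (h : Setup n hn d p q τ O) :
    estimateVar (Composition.single n hn) τ O =
      ((n : ℝ) + d) / ((n : ℝ) + d + 1) *
        ((O ^ 2).trace.re + 2 * p * ((O ^ 2) 0 0).re + 2 * q * ((O ^ 2) 1 1).re
          + 2 * p * q * ‖O 0 1‖ ^ 2
          - p * (O 0 0).re ^ 2 - q * (O 1 1).re ^ 2)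
      - 1 / ((n : ℝ) + d + 1) *
        ((p : ℝ) ^ 2 * (O 0 0).re ^ 2 + (q : ℝ) ^ 2 * (O 1 1).re ^ 2
          + 2 * p * q * (O 0 0).re * (O 1 1).re) := by
  have hO := h.hermitian
  have hpos : (n + d + 1 : ℝ) ≠ 0 := by positivity
  have hvar := add_one_mul_estimateVar_dickeState hn ((sum_pairWeight p q).trans h.add_eq) hO
  have htr : ((O ^ 2).trace.re : ℂ) = (O ^ 2).trace := by
    rw [sq, ofReal_re_trace_mul hO hO]
  have hdiag (i : Fin d) : ((O i i).re : ℂ) = O i i := hO.coe_re_apply_self i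
  have hsq_diag (i : Fin d) : (((O ^ 2) i i).re : ℂ) = (O ^ 2) i i :=
    (hO.pow 2).coe_re_apply_self i
  rw [← h.estimateVar_eq_dickeState, trace_mul_scaledMean_pairWeight, h.traceless,
    trace_sq_mul_scaledMean_pairWeight, sum_pairWeight_mul_apply_self_sq h.two_le, ← htr,
    ← hdiag 0, ← hdiag 1, ← hsq_diag 0, ← hsq_diag 1, mul_apply_swap_eq_sq_norm hO] at hvar
  norm_cast at hvar
  push_cast at hvar
  field_simp
  linear_combination hvar

theorem Setup.mul_le_estimateVar (h : Setup n hn d p q τ O) (hb : HasHadamardBlock O) :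
    (p * q : ℝ) ≤ estimateVar (Composition.single n hn) τ O := by
  obtain ⟨h00, h01, -, h11⟩ := hb
  have hO := h.hermitian
  have hsq0 : (1 : ℝ) ≤ ((O ^ 2) 0 0).re := by
    simpa [h00] using sq_norm_apply_le_re_sq_apply_self hO 0 0
  have hsq1 : (1 : ℝ) ≤ ((O ^ 2) 1 1).re := by
    simpa [h11] using sq_norm_apply_le_re_sq_apply_self hO 1 1
  have htr := re_trace_sq_nonneg hO
  have hn' : (n : ℝ) = p + q := by exact_mod_cast h.add_eq.symm
  have hbracket : 2 * p * q + n ≤ (O ^ 2).trace.re + 2 * p * ((O ^ 2) 0 0).re +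
      2 * q * ((O ^ 2) 1 1).re + 2 * p * q - p - q := by
    nlinarith
  have hpoly : (p * q : ℝ) * (n + d + 1) ≤ (n + d) * (2 * p * q + n) - (p - q) ^ 2 := by
    rw [hn', ← sub_nonneg]
    calc (0 : ℝ) ≤ p * q * (p + q + d) + 3 * (p * q) + d * (p + q) := by positivity
      _ = _ := by ring
  rw [h.estimateVar_eq, h00, h01, h11, div_mul_eq_mul_div, div_mul_eq_mul_div, ← sub_div,
    le_div_iff₀ (by positivity)]
  simp only [Complex.one_re, Complex.neg_re, norm_one]
  linarith [mul_le_mul_of_nonneg_left hbracket (by positivity : (0 : ℝ) ≤ n + d)]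

end OneRow

theorem exists_forall_ge_add_mul_lt_mul_sq (a b : ℝ) {c : ℝ} (hc : 0 < c) :
    ∃ N : ℕ, ∀ n : ℕ, N ≤ n → a + b * n < c * (n : ℝ) ^ 2 := by
  have hlim : Filter.Tendsto (fun n : ℕ => (n : ℝ) * (c * n - b)) Filter.atTop Filter.atTop :=
    tendsto_natCast_atTop_atTop.atTop_mul_atTop₀ <|
      Filter.tendsto_atTop_add_const_right _ _ (tendsto_natCast_atTop_atTop.const_mul_atTop hc)
  obtain ⟨N, hN⟩ := (hlim.eventually_gt_atTop a).exists_forall_of_atTop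
  exact ⟨N, fun n hn => by linarith [hN n hn]⟩

end QuditShadow

open QuditShadow in
theorem mainTheorem7 :
    -- the exact formula
    (∀ (n : ℕ) (hn : 0 < n) (d : ℕ) [NeZero d] (p q : ℕ) (τ : Str n d → ℂ)
        (O : Matrix (Fin d) (Fin d) ℂ), Setup n hn d p q τ O →
      IsProbabilityMeasure (outcomeLaw d (Composition.single n hn) (pureState τ)) ∧
      MemLp (estimate (Composition.single n hn) O) 2
        (outcomeLaw d (Composition.single n hn) (pureState τ)) ∧
      estimateVar (Composition.single n hn) τ O =
        ((n : ℝ) + d) / ((n : ℝ) + d + 1) *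
          ((O ^ 2).trace.re + 2 * p * ((O ^ 2) 0 0).re + 2 * q * ((O ^ 2) 1 1).re
            + 2 * p * q * ‖O 0 1‖ ^ 2
            - p * (O 0 0).re ^ 2 - q * (O 1 1).re ^ 2)
        - 1 / ((n : ℝ) + d + 1) *
          ((p : ℝ) ^ 2 * (O 0 0).re ^ 2 + (q : ℝ) ^ 2 * (O 1 1).re ^ 2
            + 2 * p * q * (O 0 0).re * (O 1 1).re)) ∧
    -- the scaled variance is bounded below when `p, q = Θ(n)` (here `p, q ≤ n` is automatic)
    (∃ C₁ : ℝ, 0 < C₁ ∧ ∀ c : ℝ, 0 < c → ∃ C₂ : ℝ, 0 < C₂ ∧ ∃ N : ℕ,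
      ∀ (n : ℕ) (hn : 0 < n) (d : ℕ) [NeZero d] (p q : ℕ) (τ : Str n d → ℂ)
        (O : Matrix (Fin d) (Fin d) ℂ), Setup n hn d p q τ O → HasHadamardBlock O →
        N ≤ n → c * n ≤ p → c * n ≤ q →
        C₁ * (((p : ℝ) * q / (n : ℝ) ^ 2) * ‖O 0 1‖ ^ 2) ≤
            1 / (n : ℝ) ^ 2 * estimateVar (Composition.single n hn) τ O ∧
          C₂ ≤ C₁ * (((p : ℝ) * q / (n : ℝ) ^ 2) * ‖O 0 1‖ ^ 2)) ∧
    -- no bound of the form `A tr(O²) + B n ‖O²‖` holds, whatever the constants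
    (∀ (d : ℕ) [NeZero d] (O : Matrix (Fin d) (Fin d) ℂ), 2 ≤ d → O.IsHermitian → O.trace = 0 →
      HasHadamardBlock O → ∀ c : ℝ, 0 < c → ∀ A B : ℝ, ∃ N : ℕ,
      ∀ (n : ℕ) (hn : 0 < n) (p q : ℕ), p + q = n → N ≤ n → c * n ≤ p → c * n ≤ q →
        ∃ τ : Str n d → ℂ, Setup n hn d p q τ O ∧
          A * (O ^ 2).trace.re + B * n * specNorm (O ^ 2) <
            estimateVar (Composition.single n hn) τ O) := by
  have hpq {c : ℝ} (hc : 0 < c) {n p q : ℕ} (hp : c * n ≤ p) (hq : c * n ≤ q) :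
      c ^ 2 * (n : ℝ) ^ 2 ≤ p * q := by
    rw [← mul_pow, sq]
    gcongr
  refine ⟨fun n hn d _ p q τ O h => ⟨h.isProbabilityMeasure_outcomeLaw, h.memLp_estimate,
    h.estimateVar_eq⟩, ⟨1, one_pos, fun c hc => ⟨c ^ 2, by positivity, 0, ?_⟩⟩, ?_⟩
  · intro n hn d _ p q τ O h hb _ hp hq
    rw [hb.2.1, norm_one, one_pow, mul_one, one_mul, one_div_mul_eq_div]
    refine ⟨by gcongr; exact h.mul_le_estimateVar hb, ?_⟩
    exact (le_div_iff₀ (by positivity)).mpr (hpq hc hp hq)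
  · intro d _ O hd hO htr hb c hc A B
    obtain ⟨N, hN⟩ := exists_forall_ge_add_mul_lt_mul_sq (A * (O ^ 2).trace.re)
      (B * specNorm (O ^ 2)) (pow_pos hc 2)
    refine ⟨N, fun n hn p q hadd hNn hp hq => ⟨_, setup_dickeState hn hd hadd hO htr, ?_⟩⟩
    rw [mul_right_comm B]
    exact (hN n hNn).trans_le
      ((hpq hc hp hq).trans ((setup_dickeState hn hd hadd hO htr).mul_le_estimateVar hb))
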